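/- \textbf{Setting.} Thompson's group $T$ is the group of orientation-preserving homeomorphisms of $S^1=\mathbb R/\mathbb Z$ that preserve the dyadic points and, outside finitely many dyadic points, are locally affine with slope a power of $2$; products are compositions, $(fg)(z)=f(g(z))$. A \emph{marked tree pair diagram} $(T_-,T_+)$ consists of two finite rooted binary trees with the same number $N$ of leaves and a marked leaf of $T_+$. The leaves of a tree are numbered $0,\dots,N-1$ from left to right; in the \emph{cyclic labelling} of $T_+$ the marked leaf has label $0$ and the labels increase from left to right, wrapping around. The diagram represents the element of $T$ that maps, for each $l$, the dyadic interval of leaf $l$ of $T_-$ linearly onto the interval of the leaf of $T_+$ with cyclic label $l$. A caret is a node together with its two downward edges. Let $R_n$ be the all-right tree with $n$ carets (a root caret and $n-1$ right carets). Then $c_n$ is the element with diagram $(R_{n+1},R_{n+1})$ and mark on the rightmost leaf, and $x_n$ is the element with diagram $(R_{n+2},T_+)$ and mark on the leftmost leaf, where $T_+$ is $R_{n+1}$ with one more caret attached at leaf $n$. Let $(T_-,T_+)$ be a marked tree pair diagram in which each tree has $i+1$ carets, and let $R=R_{i+1}$. The \emph{$pcq$ factorization} associated to it is the word $p\,c_i^{j}\,q$,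 where $p=x_{i_1}^{r_1}\cdots x_{i_n}^{r_n}$ ($i_1<\dots<i_n$, $r_s>0$) is the positive normal form of the element with diagram $(R,T_+)$, ignoring the mark; $c_i^j$ is the element with diagram $(R,R)$ and the given mark; and $q=x_{j_m}^{-s_m}\cdots x_{j_1}^{-s_1}$ ($j_1<\dots<j_m$, $s_t>0$) is the negative normal form of the element with diagram $(T_-,R)$. A \emph{reducible caret pair} with left leaf $k$ consists of a caret of $T_-$ whose two leaves are leaves of $T_-$ with numbers $k,k+1$ and a caret of $T_+$ whose two leaves are leaves of $T_+$ with cyclic labels $k,k+1$; the reduction removes both carets, and if $k=0$ the mark moves to the leaf that replaces the removed caret. \textbf{Theorem.} Let $w=p\,c_i^j\,q$ with $1\le j<i+2$ be the $pcq$ factorization associated to a marked tree pair diagram in which each tree has $i+1$ carets. If the diagram has a reducible caret pair with left leaf $k$, then one of the following holds. \begin{itemize} \item[(1)] $j\le k<i$; the generators $x_{k-j}$ and $x_k^{-1}$ appear in $w$, and neither $x_{k-j+1}$ nor $x_{k+1}^{-1}$ appears. The relator is $x_{k-j}\,c_i^j\,x_k^{-1}=c_{i-1}^j$. \item[(2)]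 $k=i\ge j$; the generator $x_{i-j}$ appears in $w$, and $x_{i-j+1}$ does not. The relator is $x_{i-j}\,c_i^j=c_{i-1}^j$. \item[(3)] $0\le k<j-2$; the generators $x_{k+i-j+2}$ and $x_k^{-1}$ appear in $w$, and neither $x_{k+i-j+3}$ nor $x_{k+1}^{-1}$ appears. The relator is $x_{k+i-j+2}\,c_i^j\,x_k^{-1}=c_{i-1}^{j-1}$. \item[(4)] $k=j-2\ge 0$; the generator $x_{j-2}^{-1}$ appears in $w$, and $x_{j-1}^{-1}$ does not. The relator is $c_i^j\,x_{j-2}^{-1}=c_{i-1}^{j-1}$. \end{itemize} In each case the stated relator holds in $T$, and the reduction corresponds to applying it: using the relators $x_bx_a=x_ax_{b+1}$ ($a<b$) of $F$ in the positive word $p$ and in the positive word $q^{-1}$, one can rewrite $p=p'x_{k-j}$, $q=x_k^{-1}q'$ in case (1), $p=p'x_{i-j}$, $q'=q$ in case (2), $p=p'x_{k+i-j+2}$, $q=x_k^{-1}q'$ in case (3), and $p'=p$, $q=x_{j-2}^{-1}q'$ in case (4), in such a way that the word $p'\,c_{i-1}^{j'}\,q'$ obtained by applying the relator to the middle part, with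 $j'=j$ in cases (1), (2) and $j'=j-1$ in cases (3), (4), is the $pcq$ factorization associated to the diagram with $i$ carets in each tree that results from removing the reducible caret pair. (Here $x_a$ appears in $w$ if it is a letter of $p$, and $x_a^{-1}$ appears in $w$ if it is a letter of $q$.) -/

import Mathlib

open Topology

namespace Thompson

/-! ### Thompson's group `T` as a group of homeomorphisms of the circle `ℝ / ℤ` -/

/-- A point of the circle is dyadic if it is the image of a dyadic rational. -/
def IsDyadic (z : UnitAddCircle) : Prop :=
  ∃ (m : ℤ) (n : ℕ), z = (((m : ℝ) / 2 ^ n : ℝ) : UnitAddCircle)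

/-- Thompson's group `T`: the homeomorphisms of the circle that preserve the dyadic points and
that, outside a finite set of dyadic points, are locally affine with slope a power of two.
The slopes `2 ^ n` are positive, so these maps are orientation preserving.
The product is composition: `(f * g) z = f (g z)`. -/
def T : Subgroup (UnitAddCircle ≃ₜ UnitAddCircle) where
  carrier := {f | (∀ z, IsDyadic (f z) ↔ IsDyadic z) ∧
    ∃ B : Set UnitAddCircle, B.Finite ∧ (∀ z ∈ B, IsDyadic z) ∧
      ∀ z, z ∉ B → ∃ n : ℤ, ∀ᶠ t : ℝ in 𝓝 0,
        f (z + (t : UnitAddCircle)) = f z + (((2 : ℝ) ^ n * t : ℝ) : UnitAddCircle)}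
  mul_mem' := by
    rintro f g ⟨hf, B, hB, hBd, hBl⟩ ⟨hg, C, hC, hCd, hCl⟩
    refine ⟨fun z => (hf (g z)).trans (hg z), C ∪ g ⁻¹' B, ?_, ?_, ?_⟩
    · exact hC.union (hB.preimage g.injective.injOn)
    · rintro z (hz | hz)
      · exact hCd z hz
      · exact (hg z).1 (hBd _ hz)
    · intro z hz
      have h1 : z ∉ C := fun h => hz (Or.inl h)
      have h2 : g z ∉ B := fun h => hz (Or.inr h)
      obtain ⟨n, hn⟩ := hCl z h1
      obtain ⟨m, hm⟩ := hBl _ h2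
      refine ⟨m + n, ?_⟩
      have ht : Filter.Tendsto (fun t : ℝ => (2 : ℝ) ^ n * t) (𝓝 0) (𝓝 0) := by
        have : Continuous (fun t : ℝ => (2 : ℝ) ^ n * t) := by fun_prop
        simpa using this.tendsto 0
      filter_upwards [hn, ht.eventually hm] with t h3 h4
      change f (g _) = f (g _) + _
      rw [h3, h4, zpow_add₀ two_ne_zero, mul_assoc]
  one_mem' := by
    refine ⟨fun z => Iff.rfl, ∅, Set.finite_empty, by simp, fun z _ => ⟨0, ?_⟩⟩
    filter_upwards with t
    change z + (t : UnitAddCircle) = z + _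
    simp
  inv_mem' := by
    rintro f ⟨hf, B, hB, hBd, hBl⟩
    have hs : ∀ z, f (f⁻¹ z) = z := fun z => f.apply_symm_apply z
    have hs' : ∀ z, f⁻¹ (f z) = z := fun z => f.symm_apply_apply z
    refine ⟨fun z => ?_, f '' B, hB.image f, ?_, ?_⟩
    · rw [← hf, hs]
    · rintro _ ⟨z, hz, rfl⟩
      exact (hf z).2 (hBd z hz)
    · intro z hz
      have h1 : f⁻¹ z ∉ B := fun h => hz ⟨_, h, hs z⟩
      obtain ⟨n, hn⟩ := hBl _ h1
      refine ⟨-n, ?_⟩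
      have ht : Filter.Tendsto (fun t : ℝ => (2 : ℝ) ^ (-n) * t) (𝓝 0) (𝓝 0) := by
        have : Continuous (fun t : ℝ => (2 : ℝ) ^ (-n) * t) := by fun_prop
        simpa using this.tendsto 0
      filter_upwards [ht.eventually hn] with t h3
      have h4 : (2 : ℝ) ^ n * (2 ^ (-n) * t) = t := by
        rw [← mul_assoc, ← zpow_add₀ two_ne_zero]; simp
      rw [h4, hs] at h3
      rw [← h3, hs']

/-! ### Trees

A finite rooted binary tree is an element of `BinaryTree Unit`: `nil` is a single leaf, and
`node () l r` is a root caret with `l` and `r` hanging from its two edges. The number of carets is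
`numNodes`. The leaves are numbered `0, 1, …, numLeaves - 1` from left to right. -/

/-- The left endpoint of the dyadic subinterval of `[0, 1]` that corresponds to leaf `a`. -/
noncomputable def leafLeft : BinaryTree Unit → ℕ → ℝ
  | .nil, _ => 0
  | .node _ l r, a =>
    if a < l.numLeaves then leafLeft l a / 2 else 1 / 2 + leafLeft r (a - l.numLeaves) / 2

/-- The depth of leaf `a`; the corresponding subinterval of `[0, 1]` has length
`(1 / 2) ^ leafDepth t a`. -/
def leafDepth : BinaryTree Unit → ℕ → ℕ
  | .nil, _ => 0
  | .node _ l r, a =>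
    if a < l.numLeaves then leafDepth l a + 1 else leafDepth r (a - l.numLeaves) + 1

/-- The point of the subinterval corresponding to leaf `a` that divides it in ratio `s : 1 - s`. -/
noncomputable def leafPoint (t : BinaryTree Unit) (a : ℕ) (s : ℝ) : ℝ :=
  leafLeft t a + s * (1 / 2) ^ leafDepth t a

/-- The all-right tree with `n` carets: a root caret together with `n - 1` right carets. -/
def allRight : ℕ → BinaryTree Unit
  | 0 => .nil
  | n + 1 => .node () .nil (allRight n)

/-- The tree with `n + 2` carets that consists of a root caret, `n` right carets, and one further
caret hanging from leaf `n`: its leaf `n` has leaf exponent `1`, the others leaf exponent `0`. -/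
def leftCaretTree : ℕ → BinaryTree Unit
  | 0 => .node () (.node () .nil .nil) .nil
  | n + 1 => .node () .nil (leftCaretTree n)

/-- `RemoveCaret t a t'`: the leaves numbered `a` and `a + 1` of `t` are the two leaves of an
exposed caret of `t`, and `t'` is obtained from `t` by removing this caret. -/
inductive RemoveCaret : BinaryTree Unit → ℕ → BinaryTree Unit → Prop
  | root : RemoveCaret (.node () .nil .nil) 0 .nil
  | left {l l' r : BinaryTree Unit} {a : ℕ} :
      RemoveCaret l a l' → RemoveCaret (.node () l r) a (.node () l' r)
  | right {l r r' : BinaryTree Unit} {a : ℕ} :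
      RemoveCaret r a r' → RemoveCaret (.node () l r) (l.numLeaves + a) (.node () l r')

/-! ### Marked tree pair diagrams -/

/-- A marked tree pair diagram: two finite rooted binary trees with the same number of leaves and
a marked leaf of the target tree, given by its number from the left. -/
structure MarkedDiagram where
  source : BinaryTree Unit
  target : BinaryTree Unit
  numLeaves_eq : source.numLeaves = target.numLeaves
  mark : ℕ
  mark_lt : mark < target.numLeaves

/-- The cyclic label of leaf `a` of the target tree: the marked leaf has label `0`, and the labels
increase from left to right, wrapping back to the left after the rightmost leaf. -/
def MarkedDiagram.cyclicLabel (D : MarkedDiagram) (a : ℕ) : ℕ :=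
  (a + D.target.numLeaves - D.mark) % D.target.numLeaves

/-- `D` represents the circle map `f`: for each leaf `a` of the target tree, `f` maps the interval
of the leaf of the source tree whose number is the cyclic label of `a` linearly onto the interval
of `a`. -/
def MarkedDiagram.Represents (D : MarkedDiagram) (f : UnitAddCircle ≃ₜ UnitAddCircle) : Prop :=
  ∀ a < D.target.numLeaves, ∀ s ∈ Set.Icc (0 : ℝ) 1,
    f (leafPoint D.source (D.cyclicLabel a) s : UnitAddCircle) =
      (leafPoint D.target a s : UnitAddCircle)

/-- Auxiliary: the increasing piecewise linear map of `ℝ` that sends `a + s` to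
`leafPoint t a s`. -/
noncomputable def param : BinaryTree Unit → ℝ → ℝ
  | .nil => id
  | .node _ l r => fun x =>
    if x ≤ (l.numLeaves : ℝ) then param l x / 2 else 1 / 2 + param r (x - l.numLeaves) / 2

theorem param_zero (t : BinaryTree Unit) : param t 0 = 0 := by
  induction t with
  | nil => rfl
  | node _ l r hl hr => simp [param, hl]

theorem param_numLeaves (t : BinaryTree Unit) : param t t.numLeaves = 1 := by
  induction t with
  | nil => simp [param]
  | node _ l r hl hr =>
    have h : 0 < r.numLeaves := r.numLeaves_pos
    simp only [param, BinaryTree.numLeaves, Nat.cast_add]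
    rw [if_neg (by simpa using h.ne'), add_sub_cancel_left, hr]
    norm_num

theorem param_of_ge (u : Unit) (l r : BinaryTree Unit) {x : ℝ} (hx : (l.numLeaves : ℝ) ≤ x) :
    param (.node u l r) x = 1 / 2 + param r (x - l.numLeaves) / 2 := by
  rcases hx.eq_or_lt with rfl | h
  · simp [param, param_numLeaves, param_zero]
  · simp only [param]
    rw [if_neg (not_le.2 h)]

theorem param_strictMono (t : BinaryTree Unit) : StrictMono (param t) := by
  induction t with
  | nil => exact strictMono_id
  | node u l r hl hr =>
    intro x y hxy
    rcases le_or_gt y (l.numLeaves : ℝ) with hy | hy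
    · have := hl hxy
      simp only [param]
      rw [if_pos hy, if_pos (hxy.le.trans hy)]
      linarith
    · rw [param_of_ge u l r hy.le]
      rcases le_or_gt (l.numLeaves : ℝ) x with hx | hx
      · rw [param_of_ge u l r hx]
        have := hr (sub_lt_sub_right hxy (l.numLeaves : ℝ))
        linarith
      · have h1 := hl hx
        have h2 := hr (sub_pos.2 hy)
        rw [param_numLeaves] at h1
        rw [param_zero] at h2
        simp only [param]
        rw [if_pos hx.le]
        linarith

theorem param_continuous (t : BinaryTree Unit) : Continuous (param t) := by
  induction t with
  | nil => exact continuous_id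
  | node u l r hl hr =>
    refine Continuous.if_le (by fun_prop) (by fun_prop) continuous_id continuous_const ?_
    rintro x rfl
    simp [param_numLeaves, param_zero]

theorem param_leaf (t : BinaryTree Unit) (a : ℕ) (ha : a < t.numLeaves) (s : ℝ)
    (hs : s ∈ Set.Icc (0 : ℝ) 1) : param t (a + s) = leafPoint t a s := by
  induction t generalizing a with
  | nil =>
    have : a = 0 := by simpa using ha
    subst this
    simp [param, leafPoint, leafLeft, leafDepth]
  | node u l r hl hr =>
    simp only [leafPoint, leafLeft, leafDepth] at hl hr ⊢
    split_ifs with h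
    · have h1 : (a : ℝ) + 1 ≤ l.numLeaves := by exact_mod_cast h
      have h2 : (a : ℝ) + s ≤ l.numLeaves := by linarith [hs.2]
      simp only [param]
      rw [if_pos h2, hl a h, pow_succ]
      ring
    · have h1 : l.numLeaves ≤ a := not_lt.1 h
      have h1' : (l.numLeaves : ℝ) ≤ a := by exact_mod_cast h1
      rw [param_of_ge u l r (by linarith [hs.1]), pow_succ]
      have h3 : (a : ℝ) + s - l.numLeaves = ((a - l.numLeaves : ℕ) : ℝ) + s := by
        rw [Nat.cast_sub h1]; ring
      simp only [BinaryTree.numLeaves] at ha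
      rw [h3, hr _ (by omega)]
      ring

theorem exists_paramCircle (t : BinaryTree Unit) (N : ℕ) (ht : t.numLeaves = N) :
    ∃ e : AddCircle (N : ℝ) ≃ₜ UnitAddCircle,
      ∀ x ∈ Set.Icc (0 : ℝ) N, e (x : AddCircle (N : ℝ)) = (param t x : ℝ) := by
  subst ht
  have hN : (0 : ℝ) < t.numLeaves := by exact_mod_cast t.numLeaves_pos
  have : Fact ((0 : ℝ) < t.numLeaves) := ⟨hN⟩
  set F : AddCircle (t.numLeaves : ℝ) → UnitAddCircle :=
    AddCircle.liftIco (t.numLeaves : ℝ) 0 (fun x : ℝ => ((param t x : ℝ) : UnitAddCircle)) with hF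
  have hFx : ∀ x ∈ Set.Ico (0 : ℝ) t.numLeaves,
      F (x : AddCircle (t.numLeaves : ℝ)) = (param t x : ℝ) := fun x hx =>
    AddCircle.liftIco_zero_coe_apply hx
  have hone : ((1 : ℝ) : UnitAddCircle) = 0 := AddCircle.coe_period 1
  have hcont : Continuous F := by
    refine AddCircle.liftIco_zero_continuous ?_ ?_
    · rw [param_zero, param_numLeaves, hone]; simp
    · exact ((AddCircle.continuous_mk' 1).comp (param_continuous t)).continuousOn
  have hmem : ∀ x ∈ Set.Ico (0 : ℝ) t.numLeaves, param t x ∈ Set.Ico (0 : ℝ) (0 + 1) := by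
    intro x hx
    have h1 := (param_strictMono t).monotone hx.1
    have h2 := param_strictMono t hx.2
    rw [param_zero] at h1
    rw [param_numLeaves] at h2
    exact ⟨h1, by linarith⟩
  have hrep : ∀ z : AddCircle (t.numLeaves : ℝ), ∃ x ∈ Set.Ico (0 : ℝ) t.numLeaves,
      (x : AddCircle (t.numLeaves : ℝ)) = z := by
    intro z
    have := AddCircle.coe_image_Ico_eq (t.numLeaves : ℝ) 0
    rw [zero_add] at this
    have hz : z ∈ (Set.univ : Set (AddCircle (t.numLeaves : ℝ))) := trivial
    rw [← this] at hz
    exact hz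
  have hinj : Function.Injective F := by
    intro z w hzw
    obtain ⟨x, hx, rfl⟩ := hrep z
    obtain ⟨y, hy, rfl⟩ := hrep w
    rw [hFx x hx, hFx y hy, AddCircle.coe_eq_coe_iff_of_mem_Ico (hmem x hx) (hmem y hy)] at hzw
    rw [(param_strictMono t).injective hzw]
  have hsurj : Function.Surjective F := by
    intro z
    have hz : z ∈ (Set.univ : Set UnitAddCircle) := trivial
    rw [← AddCircle.coe_image_Ico_eq (1 : ℝ) 0] at hz
    obtain ⟨y, hy, rfl⟩ := hz
    have := intermediate_value_Ico hN.le ((param_continuous t).continuousOn)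
    rw [param_zero, param_numLeaves] at this
    obtain ⟨x, hx, hxy⟩ := this (by simpa using hy)
    exact ⟨x, by rw [hFx x hx, hxy]⟩
  refine ⟨Continuous.homeoOfEquivCompactToT2 (f := Equiv.ofBijective F ⟨hinj, hsurj⟩) hcont, ?_⟩
  intro x hx
  change F x = _
  rcases hx.2.eq_or_lt with h | h
  · rw [h, param_numLeaves, hone, AddCircle.coe_period]
    have := hFx 0 ⟨le_rfl, hN⟩
    rw [param_zero] at this
    simpa using this
  · exact hFx x ⟨hx.1, h⟩

theorem exists_leafPoint (t : BinaryTree Unit) (z : UnitAddCircle) :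
    ∃ a < t.numLeaves, ∃ s ∈ Set.Ico (0 : ℝ) 1, z = (leafPoint t a s : ℝ) := by
  have hN : (0 : ℝ) < t.numLeaves := by exact_mod_cast t.numLeaves_pos
  have hz : z ∈ (Set.univ : Set UnitAddCircle) := trivial
  rw [← AddCircle.coe_image_Ico_eq (1 : ℝ) 0] at hz
  obtain ⟨y, hy, rfl⟩ := hz
  have := intermediate_value_Ico hN.le ((param_continuous t).continuousOn)
  rw [param_zero, param_numLeaves] at this
  obtain ⟨x, hx, rfl⟩ := this (by simpa using hy)
  have ha : ⌊x⌋₊ < t.numLeaves := (Nat.floor_lt hx.1).2 hx.2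
  have h1 := Nat.floor_le hx.1
  have h2 := Nat.lt_floor_add_one x
  refine ⟨⌊x⌋₊, ha, x - ⌊x⌋₊, ⟨by linarith, by linarith⟩, ?_⟩
  rw [← param_leaf t _ ha _ ⟨by linarith, by linarith⟩]
  simp

theorem leafLeft_dyadic (t : BinaryTree Unit) (a : ℕ) :
    ∃ (m : ℤ) (n : ℕ), leafLeft t a = m / 2 ^ n := by
  induction t generalizing a with
  | nil => exact ⟨0, 0, by simp [leafLeft]⟩
  | node u l r hl hr =>
    simp only [leafLeft]
    split_ifs
    · obtain ⟨m, n, h⟩ := hl a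
      exact ⟨m, n + 1, by rw [h, pow_succ]; field_simp⟩
    · obtain ⟨m, n, h⟩ := hr (a - l.numLeaves)
      exact ⟨2 ^ n + m, n + 1, by rw [h, pow_succ]; push_cast; field_simp⟩

theorem isDyadic_coe (y : ℝ) :
    IsDyadic (y : UnitAddCircle) ↔ ∃ (m : ℤ) (n : ℕ), y = m / 2 ^ n := by
  constructor
  · rintro ⟨m, n, h⟩
    have h1 : ((y - m / 2 ^ n : ℝ) : UnitAddCircle) = 0 := by
      rw [AddCircle.coe_sub, h, sub_self]
    obtain ⟨k, hk⟩ := (AddCircle.coe_eq_zero_iff (1 : ℝ)).1 h1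
    refine ⟨m + k * 2 ^ n, n, ?_⟩
    have h2 : y = m / 2 ^ n + k := by
      rw [zsmul_eq_mul, mul_one] at hk
      linarith
    rw [h2]
    push_cast
    field_simp
  · rintro ⟨m, n, h⟩
    exact ⟨m, n, by rw [h]⟩

theorem isDyadic_leafPoint (t : BinaryTree Unit) (a : ℕ) (s : ℝ) :
    IsDyadic (leafPoint t a s : ℝ) ↔ ∃ (m : ℤ) (n : ℕ), s = m / 2 ^ n := by
  rw [isDyadic_coe, leafPoint]
  obtain ⟨p, q, h⟩ := leafLeft_dyadic t a
  rw [h]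
  constructor
  · rintro ⟨m, n, h'⟩
    refine ⟨(m * 2 ^ q - p * 2 ^ n) * 2 ^ leafDepth t a, n + q, ?_⟩
    have : s * (1 / 2) ^ leafDepth t a = m / 2 ^ n - p / 2 ^ q := by linarith
    rw [one_div, inv_pow, ← div_eq_mul_inv, div_eq_iff (by positivity)] at this
    rw [this]
    push_cast
    field_simp
    ring
  · rintro ⟨m, n, rfl⟩
    refine ⟨p * 2 ^ (n + leafDepth t a) + m * 2 ^ q, q + n + leafDepth t a, ?_⟩
    push_cast
    rw [one_div, inv_pow]
    field_simp
    ring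

theorem MarkedDiagram.exists_cyclicLabel_eq (D : MarkedDiagram) {k : ℕ}
    (hk : k < D.source.numLeaves) : ∃ a < D.target.numLeaves, D.cyclicLabel a = k := by
  have h1 := D.mark_lt
  rw [D.numLeaves_eq] at hk
  simp only [MarkedDiagram.cyclicLabel]
  by_cases h : D.mark + k < D.target.numLeaves
  · refine ⟨D.mark + k, h, ?_⟩
    rw [show D.mark + k + D.target.numLeaves - D.mark = k + D.target.numLeaves by omega,
      Nat.add_mod_right, Nat.mod_eq_of_lt hk]
  · refine ⟨D.mark + k - D.target.numLeaves, by omega, ?_⟩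
    rw [show D.mark + k - D.target.numLeaves + D.target.numLeaves - D.mark = k by omega,
      Nat.mod_eq_of_lt hk]

theorem MarkedDiagram.Represents.mem_T {D : MarkedDiagram}
    {f : UnitAddCircle ≃ₜ UnitAddCircle} (hf : D.Represents f) : f ∈ T := by
  have key : ∀ z : UnitAddCircle, ∃ k < D.source.numLeaves, ∃ a < D.target.numLeaves,
      D.cyclicLabel a = k ∧ ∃ s ∈ Set.Ico (0 : ℝ) 1, z = (leafPoint D.source k s : ℝ) := by
    intro z
    obtain ⟨k, hk, s, hs, h⟩ := exists_leafPoint D.source z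
    obtain ⟨a, ha, rfl⟩ := D.exists_cyclicLabel_eq hk
    exact ⟨_, hk, a, ha, rfl, s, hs, h⟩
  refine ⟨?_, (fun k : ℕ => ((leafLeft D.source k : ℝ) : UnitAddCircle)) ''
    (Set.Iio D.source.numLeaves), (Set.finite_Iio _).image _, ?_, ?_⟩
  · intro z
    obtain ⟨_, -, a, ha, rfl, s, hs, rfl⟩ := key z
    rw [hf a ha s ⟨hs.1, hs.2.le⟩, isDyadic_leafPoint, isDyadic_leafPoint]
  · rintro _ ⟨k, -, rfl⟩
    exact (isDyadic_coe _).2 (leafLeft_dyadic _ _)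
  · intro z hz
    obtain ⟨k, hk, a, ha, hak, s, hs, rfl⟩ := key z
    have hs0 : 0 < s := by
      rcases hs.1.eq_or_lt with h | h
      · exact absurd ⟨k, hk, by simp [leafPoint, ← h]⟩ hz
      · exact h
    set d := leafDepth D.source k with hd
    set e := leafDepth D.target a with he
    refine ⟨(d : ℤ) - e, ?_⟩
    have hc : Continuous (fun t : ℝ => s + 2 ^ d * t) := by fun_prop
    have ht := hc.tendsto 0
    rw [mul_zero, add_zero] at ht
    filter_upwards [ht.eventually (Icc_mem_nhds hs0 hs.2)] with t h
    have h1 : leafPoint D.source k s + t = leafPoint D.source k (s + 2 ^ d * t) := by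
      simp only [leafPoint, ← hd, one_div, inv_pow]
      field_simp
      ring
    have h2 : leafPoint D.target a s + 2 ^ ((d : ℤ) - e) * t =
        leafPoint D.target a (s + 2 ^ d * t) := by
      simp only [leafPoint, ← he, one_div, inv_pow]
      rw [zpow_sub₀ two_ne_zero, zpow_natCast, zpow_natCast]
      field_simp
      ring
    rw [← AddCircle.coe_add, h1, ← hak, hf a ha _ h, hf a ha _ ⟨hs.1, hs.2.le⟩,
      ← AddCircle.coe_add, h2]

theorem MarkedDiagram.exists_represents (D : MarkedDiagram) :
    ∃ g : T, D.Represents (g : UnitAddCircle ≃ₜ UnitAddCircle) := by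
  obtain ⟨N, hN⟩ : ∃ N, N = D.target.numLeaves := ⟨_, rfl⟩
  obtain ⟨eS, hS⟩ := exists_paramCircle D.source N (D.numLeaves_eq.trans hN.symm)
  obtain ⟨eT, hT⟩ := exists_paramCircle D.target N hN.symm
  have hpos : 0 < N := hN ▸ D.target.numLeaves_pos
  have hm : D.mark < N := hN ▸ D.mark_lt
  have hrep : D.Represents (eS.symm.trans
      ((Homeomorph.addRight ((D.mark : ℝ) : AddCircle (N : ℝ))).trans eT)) := by
    intro a ha s hs
    rw [← hN] at ha
    have hL : D.cyclicLabel a < N := by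
      rw [MarkedDiagram.cyclicLabel, ← hN]; exact Nat.mod_lt _ hpos
    have hmem : ∀ b < N, (b : ℝ) + s ∈ Set.Icc (0 : ℝ) N := by
      intro b hb
      have : (b : ℝ) + 1 ≤ N := by exact_mod_cast hb
      exact ⟨add_nonneg b.cast_nonneg hs.1, by linarith [hs.2]⟩
    have h1 : eS.symm ((leafPoint D.source (D.cyclicLabel a) s : ℝ) : UnitAddCircle) =
        (((D.cyclicLabel a : ℝ) + s : ℝ) : AddCircle (N : ℝ)) := by
      rw [Homeomorph.symm_apply_eq, hS _ (hmem _ hL),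
        param_leaf _ _ (by rw [D.numLeaves_eq, ← hN]; exact hL) s hs]
    have h2 : ∃ n : ℕ, D.cyclicLabel a + D.mark + n * N = a + N := by
      refine ⟨(a + N - D.mark) / N, ?_⟩
      have := Nat.mod_add_div' (a + N - D.mark) N
      simp only [MarkedDiagram.cyclicLabel, ← hN]
      omega
    obtain ⟨n, hn⟩ := h2
    have h3 : (((D.cyclicLabel a : ℝ) + s : ℝ) : AddCircle (N : ℝ)) + ((D.mark : ℝ) : AddCircle (N : ℝ))
        = (((a : ℝ) + s : ℝ) : AddCircle (N : ℝ)) := by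
      rw [← AddCircle.coe_add, ← sub_eq_zero, ← AddCircle.coe_sub, AddCircle.coe_eq_zero_iff]
      refine ⟨1 - n, ?_⟩
      have hn' : (D.cyclicLabel a : ℝ) + D.mark + n * N = a + N := by exact_mod_cast hn
      rw [zsmul_eq_mul]
      push_cast
      linarith
    simp only [Homeomorph.trans_apply, Homeomorph.coe_addRight]
    rw [h1, h3, hT _ (hmem a ha), param_leaf _ _ (hN ▸ ha) s hs]
  exact ⟨⟨_, hrep.mem_T⟩, hrep⟩

/-- The element of `T` represented by a marked tree pair diagram. -/
noncomputable def MarkedDiagram.toT (D : MarkedDiagram) : T :=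
  Classical.choose D.exists_represents

theorem MarkedDiagram.represents_toT (D : MarkedDiagram) :
    D.Represents (D.toT : UnitAddCircle ≃ₜ UnitAddCircle) :=
  Classical.choose_spec D.exists_represents

theorem numLeaves_allRight (n : ℕ) : (allRight n).numLeaves = n + 1 := by
  induction n with
  | zero => rfl
  | succ n ih => simp only [allRight, BinaryTree.numLeaves, ih]; omega

theorem numLeaves_leftCaretTree (n : ℕ) : (leftCaretTree n).numLeaves = n + 3 := by
  induction n with
  | zero => rfl
  | succ n ih => simp only [leftCaretTree, BinaryTree.numLeaves, ih]; omega

/-! ### Generators -/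

/-- The generator `x_n` of `T` (which lies in Thompson's group `F`). -/
noncomputable def x (n : ℕ) : T :=
  MarkedDiagram.toT
    { source := allRight (n + 2)
      target := leftCaretTree n
      numLeaves_eq := by rw [numLeaves_allRight, numLeaves_leftCaretTree]
      mark := 0
      mark_lt := by rw [numLeaves_leftCaretTree]; omega }

/-- The torsion generator `c_n` of `T`: both trees are the all-right tree with `n + 1` carets, and
the mark is on the rightmost leaf of the target tree. -/
noncomputable def c (n : ℕ) : T :=
  MarkedDiagram.toT
    { source := allRight (n + 1)
      target := allRight (n + 1)
      numLeaves_eq := rfl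
      mark := n + 1
      mark_lt := by rw [numLeaves_allRight]; omega }

/-! ### Words

A list `[a₁, …, aₙ]` of natural numbers stands for the positive word `x_{a₁} ⋯ x_{aₙ}`. The
generator `x_a` appears in the word if `a` is a member of the list. -/

/-- The element of `T` given by the positive word `u`. -/
noncomputable def eval (u : List ℕ) : T := (u.map x).prod

/-- One application of a relator `x_b x_a = x_a x_{b+1}`, `a < b`, of `F` to a positive word. -/
inductive FStep : List ℕ → List ℕ → Prop
  | mk (s t : List ℕ) (a b : ℕ) (h : a < b) : FStep (s ++ [b, a] ++ t) (s ++ [a, b + 1] ++ t)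

/-- The positive words `u` and `v` can be transformed into each other by applying the relators
`x_b x_a = x_a x_{b+1}`, `a < b`, of `F` (in either direction). -/
def FEquiv (u v : List ℕ) : Prop := Relation.EqvGen FStep u v

/-! ### The factorization associated to a marked tree pair diagram -/

/-- The diagram `(R, T₊)`, where `R` is the all-right tree with as many carets as the trees of `D`,
ignoring the marking (that is, with the mark on leaf `0`). -/
def MarkedDiagram.positivePart (D : MarkedDiagram) : MarkedDiagram where
  source := allRight D.target.numNodes
  target := D.target
  numLeaves_eq := by rw [numLeaves_allRight, BinaryTree.numLeaves_eq_numNodes_succ]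
  mark := 0
  mark_lt := D.target.numLeaves_pos

/-- The diagram `(R, R)` with the mark of `D`. -/
def MarkedDiagram.torsionPart (D : MarkedDiagram) : MarkedDiagram where
  source := allRight D.target.numNodes
  target := allRight D.target.numNodes
  numLeaves_eq := rfl
  mark := D.mark
  mark_lt := by
    rw [numLeaves_allRight, ← BinaryTree.numLeaves_eq_numNodes_succ]; exact D.mark_lt

/-- The diagram `(T₋, R)`, without marking (that is, with the mark on leaf `0`). -/
def MarkedDiagram.negativePart (D : MarkedDiagram) : MarkedDiagram where
  source := D.source
  target := allRight D.target.numNodes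
  numLeaves_eq := by
    rw [numLeaves_allRight, ← BinaryTree.numLeaves_eq_numNodes_succ, D.numLeaves_eq]
  mark := 0
  mark_lt := by rw [numLeaves_allRight]; omega

/-- The word `p c_i^j q⁻¹`, where `p` and `q` are positive words, is the pcq factorization
associated to the diagram `D`: both trees of `D` have `i + 1` carets, the positive word `p` is the
normal form of the element with diagram `(R, T₊)`, the power `c_i^j` is the cyclic permutation of
the leaves of `R` given by the marking of `D`, and the negative word `q⁻¹` is the normal form of the
element with diagram `(T₋, R)`. A positive (negative) word is in normal form if the indices of its
generators are in increasing (decreasing) order. -/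
structure MarkedDiagram.IsFactorization (D : MarkedDiagram) (p : List ℕ) (i j : ℕ) (q : List ℕ) :
    Prop where
  numNodes_source : D.source.numNodes = i + 1
  numNodes_target : D.target.numNodes = i + 1
  sorted_p : p.Pairwise (· ≤ ·)
  eval_p : eval p = D.positivePart.toT
  pow_c : c i ^ j = D.torsionPart.toT
  sorted_q : q.Pairwise (· ≤ ·)
  eval_q : (eval q)⁻¹ = D.negativePart.toT

/-! ### Reductions -/

/-- The leaves labelled `k` and `k + 1` (in the source tree: from left to right; in the target tree:
in the cyclic labelling) form an exposed caret in both trees of `D`, and `D'` is the diagram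
obtained by removing this reducible pair of carets. -/
def MarkedDiagram.ReducesTo (D : MarkedDiagram) (k : ℕ) (D' : MarkedDiagram) : Prop :=
  RemoveCaret D.source k D'.source ∧
    ∃ a, RemoveCaret D.target a D'.target ∧ D.cyclicLabel a = k ∧ D.cyclicLabel (a + 1) = k + 1 ∧
      D'.mark = if a < D.mark then D.mark - 1 else D.mark

end Thompson

namespace Thompson

/-! A diagram is handled through the predicate `MapsLeaves`: leaf `l` of one tree goes linearly onto
leaf `l + m` of another, modulo the number of leaves. Two trees and a shift determine the element of
`T` (`MapsLeaves.unique`), such maps compose (`MapsLeaves.comp`), and carets attached at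
corresponding leaves do not change the element (`MapsLeaves.addCaret`). So every identity in `T`
below is proved by exhibiting the same trees and shift for both sides.

On the all-right side, `x_a` is exactly the attachment of a caret at leaf `a`: if `f` maps an
all-right tree onto `t`, then `f * x a` maps the next all-right tree onto `t` with a caret at `a`
(`MapsLeaves.mul_x`). The last leaf is the exception: a caret there only enlarges the all-right
tree, and `f` stays the same. Hence an exposed caret of `T₊` off the last leaf splits a final letter
`x_a` off the positive word. Normal forms are unique (`eq_of_eval_eq`), so the given normal form
must be the explicit one `insertGen a u'`, from which the presence of `a`, the absence of `a + 1`
and the rewriting can be read off (`normalForm_addCaret`). Since `q` is stored as a positive word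
reaching `T₋`, the same lemma serves both trees.

The power `c_i^j` is the shift by `i + 2 - j`, so the carets at `k` and `a` match when `k = a + j`
or `k = a + j - (i + 2)`. In each alternative at most one of the two carets can sit on the last
leaf, where its generator is missing; this gives the four cases. The relators themselves all come
from `mul_c_pow_mul_inv`. -/

/-! ### Adding carets to trees -/

/-- The tree obtained by attaching a caret at leaf `a`. -/
def addCaret : BinaryTree Unit → ℕ → BinaryTree Unit
  | .nil, _ => .node () .nil .nil
  | .node _ l r, a =>
    if a < l.numLeaves then .node () (addCaret l a) r else .node () l (addCaret r (a - l.numLeaves))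

/-- Trades the removal relation for the function `addCaret`, the form in which reductions are used
from here on. -/
theorem RemoveCaret.lt_and_eq_addCaret {t t' : BinaryTree Unit} {a : ℕ} (h : RemoveCaret t a t') :
    a < t'.numLeaves ∧ t = addCaret t' a := by
  induction h with
  | root => simp [addCaret]
  | left _ ih => simp only [BinaryTree.numLeaves, addCaret, ih.1, if_true, ← ih.2, and_true]; omega
  | right _ ih => simp [addCaret, ih.1, ← ih.2]

theorem numLeaves_addCaret (t : BinaryTree Unit) (a : ℕ) :
    (addCaret t a).numLeaves = t.numLeaves + 1 := by
  induction t generalizing a with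
  | nil => rfl
  | node u l r hl hr =>
    simp only [addCaret]
    split_ifs <;> simp only [BinaryTree.numLeaves, hl, hr] <;> omega

theorem addCaret_comm (t : BinaryTree Unit) {a b : ℕ} (hab : a < b) (hb : b < t.numLeaves) :
    addCaret (addCaret t a) (b + 1) = addCaret (addCaret t b) a := by
  induction t generalizing a b with
  | nil => simp only [BinaryTree.numLeaves] at hb; omega
  | node u l r hl hr =>
    simp only [BinaryTree.numLeaves] at hb
    rcases lt_or_ge b l.numLeaves with h | h
    · have h' : a < l.numLeaves := by omega
      have h1 : b + 1 < l.numLeaves + 1 := by omega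
      have h2 : a < l.numLeaves + 1 := by omega
      simp only [addCaret, h, h', if_true, numLeaves_addCaret, h1, h2, hl hab h]
    · rcases lt_or_ge a l.numLeaves with h' | h'
      · simp only [addCaret, h', if_true, h.not_gt, if_false, numLeaves_addCaret,
          Nat.add_lt_add_iff_right, Nat.add_sub_add_right]
      · have h1 : ¬ b + 1 < l.numLeaves := by omega
        simp only [addCaret, h'.not_gt, if_false, h.not_gt, h1]
        rw [Nat.sub_add_comm h, hr (Nat.sub_lt_sub_right h' hab) (by omega)]

theorem addCaret_allRight_self (n : ℕ) : addCaret (allRight n) n = allRight (n + 1) := by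
  induction n with
  | zero => rfl
  | succ n ih => simp [allRight, addCaret, ih]

theorem addCaret_allRight_succ (n : ℕ) : addCaret (allRight (n + 1)) n = leftCaretTree n := by
  induction n with
  | zero => rfl
  | succ n ih => rw [allRight, leftCaretTree, ← ih]; simp [addCaret]

theorem exists_eq_addCaret (t : BinaryTree Unit) (ht : t ≠ .nil) :
    ∃ t' a, a < t'.numLeaves ∧ t = addCaret t' a := by
  induction t with
  | nil => exact absurd rfl ht
  | node u l r hl hr =>
    by_cases h : l = .nil
    · by_cases h' : r = .nil
      · exact ⟨.nil, 0, by simp, by rw [h, h']; rfl⟩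
      · obtain ⟨r', a, ha, rfl⟩ := hr h'
        exact ⟨.node () l r', l.numLeaves + a, by simpa using ha, by simp [addCaret]⟩
    · obtain ⟨l', a, ha, rfl⟩ := hl h
      exact ⟨.node () l' r, a, by simp only [BinaryTree.numLeaves]; omega, by simp [addCaret, ha]⟩

/-- A tree that is not all-right has an exposed caret off the right side. -/
theorem eq_allRight_or_exists_eq_addCaret (t : BinaryTree Unit) :
    (∃ n, t = allRight n) ∨ ∃ t' a, a + 1 < t'.numLeaves ∧ t = addCaret t' a := by
  induction t with
  | nil => exact Or.inl ⟨0, rfl⟩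
  | node u l r hl hr =>
    by_cases h : l = .nil
    · subst h
      rcases hr with ⟨n, rfl⟩ | ⟨r', a, ha, rfl⟩
      · exact Or.inl ⟨n + 1, rfl⟩
      · refine Or.inr ⟨.node () .nil r', a + 1, by simp only [BinaryTree.numLeaves]; omega, ?_⟩
        simp [addCaret]
    · obtain ⟨l', a, ha, rfl⟩ := exists_eq_addCaret l h
      have := r.numLeaves_pos
      exact Or.inr ⟨.node () l' r, a, by simp only [BinaryTree.numLeaves]; omega,
        by simp [addCaret, ha]⟩

theorem leafPoint_node (u : Unit) (l r : BinaryTree Unit) (a : ℕ) (s : ℝ) :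
    leafPoint (.node u l r) a s = if a < l.numLeaves then leafPoint l a s / 2
      else 1 / 2 + leafPoint r (a - l.numLeaves) s / 2 := by
  simp only [leafPoint, leafLeft, leafDepth]
  split_ifs <;> rw [pow_succ] <;> ring

/-- The subdivision of the unit interval given by `addCaret t a` halves the interval of leaf `a`
of `t` and keeps the others. -/
theorem leafPoint_addCaret (t : BinaryTree Unit) {a : ℕ} (ha : a < t.numLeaves) {b : ℕ}
    (hb : b < t.numLeaves + 1) (s : ℝ) :
    leafPoint (addCaret t a) b s = if b < a then leafPoint t b s else
      if b = a then leafPoint t a (s / 2) else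
      if b = a + 1 then leafPoint t a ((1 + s) / 2) else leafPoint t (b - 1) s := by
  induction t generalizing a b with
  | nil =>
    obtain rfl : a = 0 := by simpa using ha
    obtain rfl | rfl : b = 0 ∨ b = 1 := by simp only [BinaryTree.numLeaves] at hb; omega
    · simp [addCaret, leafPoint, leafLeft, leafDepth]
      ring
    · simp [addCaret, leafPoint, leafLeft, leafDepth]
      ring
  | node u l r hl hr =>
    simp only [BinaryTree.numLeaves] at ha hb
    have hlt : b < a ∨ b = a ∨ b = a + 1 ∨ ∃ c, b = c + 2 ∧ a ≤ c := by
      rcases Nat.lt_or_ge b (a + 2) with h | h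
      · omega
      · exact Or.inr (Or.inr (Or.inr ⟨b - 2, by omega⟩))
    rcases lt_or_ge a l.numLeaves with h | h
    · simp only [addCaret, h, if_true, leafPoint_node, numLeaves_addCaret]
      rcases lt_or_ge b (l.numLeaves + 1) with h' | h'
      · simp only [h', if_true, hl h h']
        rcases hlt with h1 | rfl | rfl | ⟨c, rfl, h1⟩
        · simp [h1, h1.trans h]
        · simp
        · simp
        · have h2 : ¬ c + 2 < a := by omega
          have h3 : ¬ c + 2 = a := by omega
          have h4 : ¬ c + 2 = a + 1 := by omega
          have h5 : c + 2 - 1 < l.numLeaves := by omega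
          simp only [h2, h3, h4, h5, if_true, if_false]
      · have h2 : ¬ b < a := by omega
        have h3 : ¬ b = a := by omega
        have h4 : ¬ b = a + 1 := by omega
        have h5 : ¬ b - 1 < l.numLeaves := by omega
        have h6 : b - (l.numLeaves + 1) = b - 1 - l.numLeaves := by omega
        simp only [h'.not_gt, h2, h3, h4, h5, h6, if_false]
    · simp only [addCaret, h.not_gt, if_false, leafPoint_node]
      rcases lt_or_ge b l.numLeaves with h' | h'
      · simp only [h', h'.trans_le h, if_true]
      · rw [hr (show a - l.numLeaves < _ by omega) (by omega)]
        rcases hlt with h1 | rfl | rfl | ⟨c, rfl, h1⟩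
        · have h2 : b - l.numLeaves < a - l.numLeaves := by omega
          simp only [h1, h2, h'.not_gt, if_true, if_false]
        · simp [h'.not_gt]
        · have h2 : a + 1 - l.numLeaves = a - l.numLeaves + 1 := by omega
          simp [h'.not_gt, h2]
        · have h2 : ¬ c + 2 < a := by omega
          have h3 : ¬ c + 2 = a := by omega
          have h4 : ¬ c + 2 = a + 1 := by omega
          have h5 : ¬ c + 2 - 1 < l.numLeaves := by omega
          have h6 : c + 2 - l.numLeaves - 1 = c + 2 - 1 - l.numLeaves := by omega
          have h7 : ¬ c + 2 - l.numLeaves < a - l.numLeaves := by omega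
          have h8 : ¬ c + 2 - l.numLeaves = a - l.numLeaves := by omega
          have h9 : ¬ c + 2 - l.numLeaves = a - l.numLeaves + 1 := by omega
          simp only [h2, h3, h4, h5, h6, h7, h8, h9, h'.not_gt, if_false]

/-! ### Maps given by a cyclic correspondence of leaves -/

/-- The map `f` sends the interval of leaf `l` of `S` linearly onto the interval of leaf `l + m` of
`t`, where the leaves are counted modulo their number `N`. -/
structure MapsLeaves (N : ℕ) (S t : BinaryTree Unit) (m : ℕ) (f : T) : Prop where
  source : S.numLeaves = N
  target : t.numLeaves = N
  map : ∀ l < N, ∀ b < N, l + m = b ∨ l + m = b + N → ∀ s ∈ Set.Icc (0 : ℝ) 1,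
    (f : UnitAddCircle ≃ₜ UnitAddCircle) (leafPoint S l s : ℝ) = (leafPoint t b s : ℝ)

variable {N m m₁ m₂ k : ℕ} {S U V : BinaryTree Unit} {f g : T}

theorem MarkedDiagram.mapsLeaves_toT (D : MarkedDiagram) :
    MapsLeaves D.target.numLeaves D.source D.target D.mark D.toT := by
  refine ⟨D.numLeaves_eq, rfl, fun l hl b hb h s hs => ?_⟩
  have h1 := D.mark_lt
  rw [← D.represents_toT b hb s hs, MarkedDiagram.cyclicLabel]
  congr 3
  rcases h with h | h
  · rw [show b + D.target.numLeaves - D.mark = l + D.target.numLeaves by omega, Nat.add_mod_right,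
      Nat.mod_eq_of_lt hl]
  · rw [show b + D.target.numLeaves - D.mark = l by omega, Nat.mod_eq_of_lt hl]

/-- The intervals of the leaves of `S` cover the circle. The bound admits `m = N`, a full turn,
because `c_i^0` appears with this shift. -/
theorem MapsLeaves.unique (hm : m ≤ N) (hf : MapsLeaves N S U m f) (hg : MapsLeaves N S U m g) :
    f = g := by
  refine Subtype.ext (Homeomorph.ext fun z => ?_)
  obtain ⟨l, hl, s, hs, rfl⟩ := exists_leafPoint S z
  rw [hf.source] at hl
  have hs' : s ∈ Set.Icc (0 : ℝ) 1 := ⟨hs.1, hs.2.le⟩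
  rcases lt_or_ge (l + m) N with h | h
  · rw [hf.map l hl _ h (Or.inl rfl) s hs', hg.map l hl _ h (Or.inl rfl) s hs']
  · have h1 : l + m - N < N := by omega
    have h2 : l + m = l + m - N + N := by omega
    rw [hf.map l hl _ h1 (Or.inr h2) s hs', hg.map l hl _ h1 (Or.inr h2) s hs']

theorem MapsLeaves.comp (hm₁ : m₁ ≤ N) (hm₂ : m₂ ≤ N) (hm : m₁ + m₂ = m ∨ m₁ + m₂ = m + N)
    (hg : MapsLeaves N U V m₂ g) (hf : MapsLeaves N S U m₁ f) :
    MapsLeaves N S V m (g * f) := by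
  refine ⟨hf.source, hg.target, fun l hl b hb h s hs => ?_⟩
  change (g : UnitAddCircle ≃ₜ UnitAddCircle) ((f : UnitAddCircle ≃ₜ UnitAddCircle) _) = _
  rcases lt_or_ge (l + m₁) N with h' | h'
  · rw [hf.map l hl _ h' (Or.inl rfl) s hs, hg.map _ h' b hb (by omega) s hs]
  · have h1 : l + m₁ - N < N := by omega
    rw [hf.map l hl _ h1 (by omega) s hs, hg.map _ h1 b hb (by omega) s hs]

theorem MapsLeaves.inv (hf : MapsLeaves N S U 0 f) : MapsLeaves N U S 0 f⁻¹ := by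
  refine ⟨hf.target, hf.source, fun l hl b hb h s hs => ?_⟩
  obtain rfl : l = b := by omega
  change (f : UnitAddCircle ≃ₜ UnitAddCircle).symm _ = _
  rw [Homeomorph.symm_apply_eq, hf.map l hl l hl (Or.inl rfl) s hs]

theorem mapsLeaves_one (S : BinaryTree Unit) : MapsLeaves S.numLeaves S S 0 1 := by
  refine ⟨rfl, rfl, fun l hl b hb h s hs => ?_⟩
  obtain rfl : l = b := by omega
  rfl

theorem leafPoint_zero_injOn (t : BinaryTree Unit) {a b : ℕ} (ha : a < t.numLeaves)
    (hb : b < t.numLeaves)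
    (h : ((leafPoint t a 0 : ℝ) : UnitAddCircle) = (leafPoint t b 0 : ℝ)) : a = b := by
  have key : ∀ c < t.numLeaves, leafPoint t c 0 = param t c ∧ param t c ∈ Set.Ico (0 : ℝ) (0 + 1) := by
    intro c hc
    refine ⟨by rw [← param_leaf t c hc 0 (by simp), add_zero], ?_, ?_⟩
    · rw [← param_zero t]
      exact (param_strictMono t).monotone c.cast_nonneg
    · rw [zero_add, ← param_numLeaves t]
      exact param_strictMono t (by exact_mod_cast hc)
  rw [(key a ha).1, (key b hb).1,
    AddCircle.coe_eq_coe_iff_of_mem_Ico (key a ha).2 (key b hb).2] at h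
  exact_mod_cast (param_strictMono t).injective h

/-- The left endpoint of leaf `0` goes to that of leaf `m`, and distinct leaves have distinct left
endpoints even on the circle. -/
theorem MapsLeaves.mark_unique (hm₁ : m₁ < N) (hm₂ : m₂ < N) (h₁ : MapsLeaves N S U m₁ f)
    (h₂ : MapsLeaves N S U m₂ f) : m₁ = m₂ := by
  have hN : 0 < N := by omega
  refine leafPoint_zero_injOn U (h₁.target ▸ hm₁) (h₁.target ▸ hm₂) ?_
  rw [← h₁.map 0 hN m₁ hm₁ (by omega) 0 (by simp), h₂.map 0 hN m₂ hm₂ (by omega) 0 (by simp)]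

/-- Attaching carets at corresponding leaves does not change the map. -/
theorem MapsLeaves.addCaret {a m' : ℕ} (hf : MapsLeaves N S U m f) (hk : k < N) (ha : a < N)
    -- If leaf `k` wraps around, its image `a` lies to the left of the mark `m`, and the extra leaf
    -- created there pushes the mark one to the right.
    (h : k + m = a ∧ m' = m ∨ k + m = a + N ∧ m' = m + 1) (hm : m < N) :
    MapsLeaves (N + 1) (addCaret S k) (addCaret U a) m' f := by
  refine ⟨by rw [numLeaves_addCaret, hf.source], by rw [numLeaves_addCaret, hf.target],
    fun l hl b hb hlb s hs => ?_⟩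
  have hs0 := hs.1
  have hs1 := hs.2
  rw [leafPoint_addCaret S (hf.source.symm ▸ hk) (hf.source.symm ▸ hl),
    leafPoint_addCaret U (hf.target.symm ▸ ha) (hf.target.symm ▸ hb)]
  rcases lt_trichotomy l k with h1 | h1 | h1
  · rw [if_pos h1]
    rcases lt_or_ge b a with h2 | h2
    · rw [if_pos h2]
      exact hf.map l (by omega) b (by omega) (by omega) s hs
    · rw [if_neg (by omega), if_neg (by omega), if_neg (by omega)]
      exact hf.map l (by omega) (b - 1) (by omega) (by omega) s hs
  · rw [if_neg (by omega), if_pos h1, if_neg (by omega), if_pos (by omega)]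
    exact hf.map k hk a ha (by omega) _ ⟨by linarith, by linarith⟩
  · rw [if_neg (by omega), if_neg (by omega)]
    rcases eq_or_ne l (k + 1) with h3 | h3
    · rw [if_pos h3, if_neg (by omega), if_neg (by omega), if_pos (by omega)]
      exact hf.map k hk a ha (by omega) _ ⟨by linarith, by linarith⟩
    · rw [if_neg h3]
      rcases lt_or_ge b a with h2 | h2
      · rw [if_pos h2]
        exact hf.map (l - 1) (by omega) b (by omega) (by omega) s hs
      · rw [if_neg (by omega), if_neg (by omega), if_neg (by omega)]
        exact hf.map (l - 1) (by omega) (b - 1) (by omega) (by omega) s hs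

/-! ### The generators -/

/-- The defining diagram is the case `M = n + 1`; further carets on the last leaf of both trees give
the larger ones. -/
theorem mapsLeaves_x {n M : ℕ} (h : n < M) :
    MapsLeaves (M + 2) (allRight (M + 1)) (addCaret (allRight M) n) 0 (x n) := by
  induction M, h using Nat.le_induction with
  | base =>
    have := MarkedDiagram.mapsLeaves_toT
      { source := allRight (n + 2), target := leftCaretTree n,
        numLeaves_eq := by rw [numLeaves_allRight, numLeaves_leftCaretTree], mark := 0,
        mark_lt := by rw [numLeaves_leftCaretTree]; omega }
    rw [addCaret_allRight_succ]
    exact numLeaves_leftCaretTree n ▸ this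
  | succ M hM ih =>
    have := ih.addCaret (k := M + 1) (a := M + 1) (m' := 0) (by omega) (by omega) (by omega)
      (by omega)
    rwa [addCaret_allRight_self, addCaret_comm _ hM (by rw [numLeaves_allRight]; omega),
      addCaret_allRight_self] at this

theorem mapsLeaves_c_pow (i : ℕ) {j : ℕ} (hj : j ≤ i + 2) :
    MapsLeaves (i + 2) (allRight (i + 1)) (allRight (i + 1)) (i + 2 - j) (c i ^ j) := by
  have h1 : MapsLeaves (i + 2) (allRight (i + 1)) (allRight (i + 1)) (i + 1) (c i) := by
    have := MarkedDiagram.mapsLeaves_toT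
      { source := allRight (i + 1), target := allRight (i + 1), numLeaves_eq := rfl,
        mark := i + 1, mark_lt := by rw [numLeaves_allRight]; omega }
    exact numLeaves_allRight (i + 1) ▸ this
  induction j with
  | zero =>
    have := mapsLeaves_one (allRight (i + 1))
    rw [numLeaves_allRight] at this
    -- For `j = 0` the shift is the full turn `i + 2`, so only `l + m = b + N` can occur, and it
    -- forces `l = b`.
    refine ⟨this.source, this.target, fun l hl b hb h s hs => ?_⟩
    obtain rfl : l = b := by omega
    rfl
  | succ j ih =>
    rw [pow_succ]
    exact (ih (by omega)).comp (by omega) (by omega) (by omega) h1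

/-- Attaching a caret to a tree that is reached from an all-right tree. -/
theorem MapsLeaves.mul_x {n a : ℕ} {t : BinaryTree Unit}
    (hf : MapsLeaves (n + 1) (allRight n) t 0 f) (ha : a < n) :
    MapsLeaves (n + 2) (allRight (n + 1)) (Thompson.addCaret t a) 0 (f * x a) :=
  -- `f` refined at leaf `a` starts at an all-right tree with a caret at `a`, which is precisely
  -- where `x a` arrives.
  (hf.addCaret (k := a) (a := a) (m' := 0) (by omega) (by omega) (by omega) (by omega)).comp
    (by omega) (by omega) (by omega) (mapsLeaves_x ha)

theorem MapsLeaves.addCaret_last {n : ℕ} {t : BinaryTree Unit}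
    (hf : MapsLeaves (n + 1) (allRight n) t 0 f) :
    MapsLeaves (n + 2) (allRight (n + 1)) (Thompson.addCaret t n) 0 f := by
  have := hf.addCaret (k := n) (a := n) (m' := 0) (by omega) (by omega) (by omega) (by omega)
  rwa [addCaret_allRight_self] at this

/-- Both products attach carets at leaves `a` and `b` of one all-right tree; attaching at `a` first
renumbers `b` as `b + 1`. -/
theorem x_mul_x {a b : ℕ} (h : a < b) : x b * x a = x a * x (b + 1) := by
  have h0 : ∀ {d e : ℕ}, d < b + 1 → e < b + 2 → MapsLeaves (b + 4) (allRight (b + 3))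
      (addCaret (addCaret (allRight (b + 1)) d) e) 0 (x d * x e) :=
    fun hd he => (mapsLeaves_x hd).mul_x he
  refine (h0 (d := b) (e := a) (by omega) (by omega)).unique (by omega) ?_
  rw [← addCaret_comm _ h (by rw [numLeaves_allRight]; omega)]
  exact h0 (by omega) (by omega)

/-! ### Positive words -/

theorem eval_cons (a : ℕ) (u : List ℕ) : eval (a :: u) = x a * eval u := by simp [eval]

theorem eval_singleton (a : ℕ) : eval [a] = x a := by simp [eval]

theorem eval_append (u v : List ℕ) : eval (u ++ v) = eval u * eval v := by simp [eval]

theorem FEquiv.eval_eq {u v : List ℕ} (h : FEquiv u v) : eval u = eval v := by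
  induction h with
  | rel _ _ h =>
    obtain ⟨s, t, a, b, h⟩ := h
    simp only [eval_append, eval_cons, mul_assoc]
    rw [← mul_assoc (x b), x_mul_x h, mul_assoc]
  | refl => rfl
  | symm _ _ _ ih => exact ih.symm
  | trans _ _ _ _ _ ih₁ ih₂ => exact ih₁.trans ih₂

theorem FEquiv.cons {u v : List ℕ} (a : ℕ) (h : FEquiv u v) : FEquiv (a :: u) (a :: v) := by
  induction h with
  | rel _ _ h =>
    obtain ⟨s, t, c, d, h⟩ := h
    exact Relation.EqvGen.rel _ _ (FStep.mk (a :: s) t c d h)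
  | refl => exact Relation.EqvGen.refl _
  | symm _ _ _ ih => exact ih.symm
  | trans _ _ _ _ _ ih₁ ih₂ => exact ih₁.trans _ _ _ ih₂

/-- The normal form of the word `u x_a`, where the positive word `u` is in normal form. -/
def insertGen (a : ℕ) : List ℕ → List ℕ
  | [] => [a]
  | b :: u => if a < b then a :: (b + 1) :: u.map (· + 1) else b :: insertGen a u

theorem mem_insertGen (a : ℕ) (u : List ℕ) : a ∈ insertGen a u := by
  induction u with
  | nil => simp [insertGen]
  | cons b u ih => rw [insertGen]; split_ifs <;> simp [ih]

theorem FEquiv_insertGen (a : ℕ) {u : List ℕ} (hu : u.Pairwise (· ≤ ·)) :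
    FEquiv (insertGen a u) (u ++ [a]) := by
  -- The tail from the first letter exceeding `a`: in a sorted word all its letters exceed `a`, and
  -- `x_a` moves left past each of them, raising it by one.
  have aux : ∀ v : List ℕ, (∀ b ∈ v, a < b) → FEquiv (a :: v.map (· + 1)) (v ++ [a]) := by
    intro v
    induction v with
    | nil => exact fun _ => Relation.EqvGen.refl _
    | cons b v ih =>
      intro hv
      have h1 : FStep (b :: a :: v.map (· + 1)) (a :: (b + 1) :: v.map (· + 1)) :=
        FStep.mk [] _ a b (hv b (by simp))
      exact (Relation.EqvGen.rel _ _ h1).symm.trans _ _ _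
        (FEquiv.cons b (ih fun c hc => hv c (by simp [hc])))
  induction u with
  | nil => exact Relation.EqvGen.refl _
  | cons b u ih =>
    rw [insertGen]
    rw [List.pairwise_cons] at hu
    split_ifs with h
    · exact aux (b :: u) (by simpa [h] using fun c hc => h.trans_le (hu.1 c hc))
    · exact FEquiv.cons b (ih hu.2)

/-- Letters at most `a` are kept and letters above `a` become at least `a + 2`, which leaves a gap
at `a + 1`. The lower bound in the last clause carries sortedness through the induction. -/
theorem insertGen_spec (a : ℕ) {u : List ℕ} (hu : u.Pairwise (· ≤ ·)) :
    (insertGen a u).Pairwise (· ≤ ·) ∧ a + 1 ∉ insertGen a u ∧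
      ∀ n, n ≤ a → (∀ b ∈ u, n ≤ b) → ∀ b ∈ insertGen a u, n ≤ b := by
  induction u with
  | nil => simp [insertGen]
  | cons b u ih =>
    rw [List.pairwise_cons] at hu
    obtain ⟨h1, h2, h3⟩ := ih hu.2
    rw [insertGen]
    split_ifs with h
    · have h4 : ∀ c ∈ u, a < c := fun c hc => h.trans_le (hu.1 c hc)
      refine ⟨?_, ?_, ?_⟩
      · simp only [List.pairwise_cons, List.mem_cons, List.mem_map, List.pairwise_map]
        refine ⟨?_, ?_, hu.2.imp (by omega)⟩
        · rintro _ (rfl | ⟨c, hc, rfl⟩)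
          · omega
          · have := h4 c hc; omega
        · rintro _ ⟨c, hc, rfl⟩
          have := hu.1 c hc; omega
      · simp only [List.mem_cons, List.mem_map, not_or]
        refine ⟨by omega, by omega, ?_⟩
        rintro ⟨c, hc, hc'⟩
        have := h4 c hc; omega
      · simp only [List.mem_cons, List.mem_map]
        rintro n hn - _ (rfl | rfl | ⟨c, hc, rfl⟩)
        · exact hn
        · omega
        · have := h4 c hc; omega
    · refine ⟨List.pairwise_cons.2 ⟨h3 b (by omega) hu.1, h1⟩, ?_, ?_⟩
      · simp only [List.mem_cons, not_or]
        exact ⟨by omega, h2⟩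
      · simp only [List.mem_cons, forall_eq_or_imp]
        exact fun n hn hb => ⟨hb.1, h3 n hn hb.2⟩

/-- Exposed carets off the last leaf are stripped one by one until an all-right tree, reached by the
empty word, remains. -/
theorem exists_sorted_word (n : ℕ) (t : BinaryTree Unit) (ht : t.numLeaves = n + 1) :
    ∃ u : List ℕ, u.Pairwise (· ≤ ·) ∧ MapsLeaves (n + 1) (allRight n) t 0 (eval u) := by
  induction n generalizing t with
  | zero =>
    rcases eq_allRight_or_exists_eq_addCaret t with ⟨n, rfl⟩ | ⟨t', a, ha, rfl⟩
    · refine ⟨[], List.Pairwise.nil, ?_⟩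
      rw [numLeaves_allRight] at ht
      obtain rfl : n = 0 := by omega
      exact mapsLeaves_one (allRight 0)
    · rw [numLeaves_addCaret] at ht; omega
  | succ n ih =>
    rcases eq_allRight_or_exists_eq_addCaret t with ⟨k, rfl⟩ | ⟨t', a, ha, rfl⟩
    · refine ⟨[], List.Pairwise.nil, ?_⟩
      rw [numLeaves_allRight] at ht
      obtain rfl : k = n + 1 := by omega
      have := mapsLeaves_one (allRight (n + 1))
      rwa [numLeaves_allRight] at this
    · rw [numLeaves_addCaret] at ht
      obtain ⟨u, hu, h⟩ := ih t' (by omega)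
      refine ⟨insertGen a u, (insertGen_spec a hu).1, ?_⟩
      rw [(FEquiv_insertGen a hu).eval_eq, eval_append, eval_singleton]
      exact h.mul_x (by omega)

/-! ### Uniqueness of normal forms -/

theorem leafLeft_allRight {n a : ℕ} (h : a ≤ n) : leafLeft (allRight n) a = 1 - (1 / 2) ^ a := by
  induction n generalizing a with
  | zero =>
    obtain rfl : a = 0 := by omega
    simp [allRight, leafLeft]
  | succ n ih =>
    rcases a with - | a
    · simp [allRight, leafLeft]
    · simp [allRight, leafLeft, ih (show a ≤ n by omega), pow_succ]
      ring

theorem leafDepth_allRight {n a : ℕ} (h : a < n) : leafDepth (allRight n) a = a + 1 := by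
  induction n generalizing a with
  | zero => omega
  | succ n ih =>
    rcases a with - | a
    · simp [allRight, leafDepth]
    · simp [allRight, leafDepth, ih (show a < n by omega)]

theorem leafPoint_allRight {n a : ℕ} (h : a < n) (s : ℝ) :
    leafPoint (allRight n) a s = 1 - (1 / 2) ^ a + s * (1 / 2) ^ (a + 1) := by
  rw [leafPoint, leafLeft_allRight h.le, leafDepth_allRight h]

theorem x_apply_leafPoint_of_lt {n a : ℕ} (h : a < n) {s : ℝ} (hs : s ∈ Set.Icc (0 : ℝ) 1) :
    (x n : UnitAddCircle ≃ₜ UnitAddCircle) ((1 - (1 / 2) ^ a + s * (1 / 2) ^ (a + 1) : ℝ)) =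
      ((1 - (1 / 2) ^ a + s * (1 / 2) ^ (a + 1) : ℝ) : UnitAddCircle) := by
  have h1 := (mapsLeaves_x (Nat.lt_succ_self n)).map a (by omega) a (by omega) (by omega) s hs
  rwa [leafPoint_addCaret _ (by rw [numLeaves_allRight]; omega) (by rw [numLeaves_allRight]; omega),
    if_pos h, leafPoint_allRight (by omega), leafPoint_allRight (by omega)] at h1

theorem x_apply_leafPoint_self (n : ℕ) {s : ℝ} (hs : s ∈ Set.Icc (0 : ℝ) 1) :
    (x n : UnitAddCircle ≃ₜ UnitAddCircle) ((1 - (1 / 2) ^ n + s * (1 / 2) ^ (n + 1) : ℝ)) =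
      ((1 - (1 / 2) ^ n + s / 2 * (1 / 2) ^ (n + 1) : ℝ) : UnitAddCircle) := by
  have h1 := (mapsLeaves_x (Nat.lt_succ_self n)).map n (by omega) n (by omega) (by omega) s hs
  rwa [leafPoint_addCaret _ (by rw [numLeaves_allRight]; omega) (by rw [numLeaves_allRight]; omega),
    if_neg (lt_irrefl n), if_pos rfl, leafPoint_allRight (by omega),
    leafPoint_allRight (by omega)] at h1

/-- The test point is the right end of the interval of leaf `n` in a large all-right tree. Each
`x_n` halves its distance to the left end, and every `x_b` with `b > n` fixes that interval. The
image therefore records how often `x_n` occurs. -/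
theorem eval_apply (n : ℕ) (u : List ℕ) (hu : ∀ b ∈ u, n ≤ b) :
    (eval u : UnitAddCircle ≃ₜ UnitAddCircle) ((1 - (1 / 2) ^ n + 1 * (1 / 2) ^ (n + 1) : ℝ)) =
      ((1 - (1 / 2) ^ n + (1 / 2) ^ u.count n * (1 / 2) ^ (n + 1) : ℝ) : UnitAddCircle) := by
  induction u with
  | nil => simp [eval]
  | cons b u ih =>
    rw [eval_cons]
    change (x b : UnitAddCircle ≃ₜ UnitAddCircle) ((eval u : UnitAddCircle ≃ₜ UnitAddCircle) _) = _
    have hs : ((1 / 2 : ℝ)) ^ u.count n ∈ Set.Icc (0 : ℝ) 1 :=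
      ⟨by positivity, pow_le_one₀ (by norm_num) (by norm_num)⟩
    rw [ih fun c hc => hu c (by simp [hc])]
    rcases (hu b (by simp)).eq_or_lt with rfl | h
    · rw [x_apply_leafPoint_self _ hs, List.count_cons_self, pow_succ (1 / 2 : ℝ) (u.count n)]
      congr 2
      ring
    · rw [x_apply_leafPoint_of_lt h hs, List.count_cons_of_ne h.ne']

theorem count_eq_of_eval_eq {n : ℕ} {u v : List ℕ} (hu : ∀ b ∈ u, n ≤ b) (hv : ∀ b ∈ v, n ≤ b)
    (h : eval u = eval v) : u.count n = v.count n := by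
  have h1 := eval_apply n u hu
  rw [h, eval_apply n v hv] at h1
  -- The images lie in `[0, 1)`, so equality on the circle is equality of reals.
  have h2 : ∀ r : ℕ, 1 - (1 / 2) ^ n + (1 / 2) ^ r * (1 / 2) ^ (n + 1) ∈ Set.Ico (0 : ℝ) (0 + 1) := by
    intro r
    have h3 : (0 : ℝ) < (1 / 2) ^ n := by positivity
    have h4 : ((1 / 2 : ℝ)) ^ n ≤ 1 := pow_le_one₀ (by norm_num) (by norm_num)
    have h5 : (0 : ℝ) < (1 / 2) ^ r := by positivity
    have h6 : ((1 / 2 : ℝ)) ^ r ≤ 1 := pow_le_one₀ (by norm_num) (by norm_num)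
    rw [pow_succ]
    exact ⟨by nlinarith, by nlinarith⟩
  rw [AddCircle.coe_eq_coe_iff_of_mem_Ico (h2 _) (h2 _), add_right_inj,
    mul_left_inj' (by positivity)] at h1
  exact (pow_right_injective₀ (by norm_num) (by norm_num) h1).symm

theorem eq_of_eval_eq {u v : List ℕ} (hu : u.Pairwise (· ≤ ·)) (hv : v.Pairwise (· ≤ ·))
    (h : eval u = eval v) : u = v := by
  -- The smallest letter of one word, if it bounds the other from below, occurs there equally often.
  -- Hence the first letters agree and can be cancelled.
  have key : ∀ {a : ℕ} {u v : List ℕ}, (a :: u).Pairwise (· ≤ ·) → (∀ b ∈ v, a ≤ b) →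
      eval (a :: u) = eval v → a ∈ v := by
    intro a u v hu hv h
    rw [List.pairwise_cons] at hu
    have := count_eq_of_eval_eq (n := a) (by simpa using hu.1) hv h
    rw [List.count_cons_self] at this
    exact List.count_pos_iff.1 (by omega)
  induction u generalizing v with
  | nil =>
    rcases v with - | ⟨b, v⟩
    · rfl
    · exact absurd (key hv (by simp) h.symm) (by simp)
  | cons a u ih =>
    rcases v with - | ⟨b, v⟩
    · exact absurd (key hu (by simp) h) (by simp)
    · have hu' := List.pairwise_cons.1 hu
      have hv' := List.pairwise_cons.1 hv
      have hab : a = b := by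
        rcases le_total a b with hab | hab
        · have := key hu (by
            simp only [List.mem_cons, forall_eq_or_imp]
            exact ⟨hab, fun c hc => hab.trans (hv'.1 c hc)⟩) h
          rcases List.mem_cons.1 this with h1 | h1
          · exact h1
          · exact le_antisymm hab (hv'.1 a h1)
        · have := key hv (by
            simp only [List.mem_cons, forall_eq_or_imp]
            exact ⟨hab, fun c hc => hab.trans (hu'.1 c hc)⟩) h.symm
          rcases List.mem_cons.1 this with h1 | h1
          · exact h1.symm
          · exact le_antisymm (hu'.1 b h1) hab
      subst hab
      rw [eval_cons, eval_cons, mul_right_inj] at h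
      rw [ih hu'.2 hv'.2 h]

/-! ### Removing a caret -/

/-- With `u'` the normal form for the smaller tree, `insertGen a u'` is a normal form for the larger
one, so uniqueness identifies it with `u`. -/
theorem normalForm_addCaret {n a : ℕ} {t : BinaryTree Unit} {u : List ℕ}
    (hu : u.Pairwise (· ≤ ·)) (ht : t.numLeaves = n + 1) (ha : a < n)
    (h : MapsLeaves (n + 2) (allRight (n + 1)) (addCaret t a) 0 (eval u)) :
    a ∈ u ∧ a + 1 ∉ u ∧ ∃ u' : List ℕ, FEquiv u (u' ++ [a]) ∧ u'.Pairwise (· ≤ ·) ∧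
      MapsLeaves (n + 1) (allRight n) t 0 (eval u') := by
  obtain ⟨u', hu', h'⟩ := exists_sorted_word n t ht
  have h1 : u = insertGen a u' := by
    refine eq_of_eval_eq hu (insertGen_spec a hu').1 (h.unique (by omega) ?_)
    rw [(FEquiv_insertGen a hu').eval_eq, eval_append, eval_singleton]
    exact h'.mul_x ha
  subst h1
  exact ⟨mem_insertGen a u', (insertGen_spec a hu').2.1, u', FEquiv_insertGen a hu', hu', h'⟩

/-- A caret on the last leaf is invisible to the element, so the word need not change. -/
theorem normalForm_addCaret_last {n : ℕ} {t : BinaryTree Unit} {f : T}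
    (ht : t.numLeaves = n + 1)
    (h : MapsLeaves (n + 2) (allRight (n + 1)) (addCaret t n) 0 f) :
    MapsLeaves (n + 1) (allRight n) t 0 f := by
  obtain ⟨u', -, h'⟩ := exists_sorted_word n t ht
  rwa [h.unique (by omega) h'.addCaret_last]

/-- The relators by which the reductions act, with `k` and `a` the left leaves of the carets
removed from the source and the target tree. -/
theorem mul_c_pow_mul_inv {i j j' a k : ℕ} {f g : T} (hj : j ≤ i + 3) (hj' : j' ≤ i + 2)
    (hj1 : 1 ≤ j') (hk : k < i + 2) (ha : a < i + 2)
    (h : k = a + j ∧ j' = j ∨ k + (i + 3) = a + j ∧ j = j' + 1)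
    (hf : MapsLeaves (i + 3) (allRight (i + 2)) (addCaret (allRight (i + 1)) a) 0 f)
    (hg : MapsLeaves (i + 3) (allRight (i + 2)) (addCaret (allRight (i + 1)) k) 0 g) :
    f * c (i + 1) ^ j * g⁻¹ = c i ^ j' := by
  -- The left side runs from the all-right tree with a caret at `k`, through the larger all-right
  -- tree rotated by `c (i + 1) ^ j`, to the one with a caret at `a`.
  have h1 := (hf.comp (m := i + 3 - j) (by omega) (by omega) (by omega)
    (mapsLeaves_c_pow (i + 1) hj)).comp (m := i + 3 - j) (by omega) (by omega) (by omega) hg.inv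
  -- The right side has the same diagram after carets are attached at `k` and `a` to that of `c i ^
  -- j'`; a wrap at this leaf adds one to the shift, which is why `j'` is `j` or `j - 1`.
  exact h1.unique (by omega) ((mapsLeaves_c_pow i hj').addCaret hk ha (by omega) (by omega))

/-- Lets `1` stand in for the missing generator in `mul_c_pow_mul_inv`, which yields the relators
with only one `x`. -/
theorem mapsLeaves_one_addCaret_last (i : ℕ) :
    MapsLeaves (i + 2) (allRight (i + 1)) (addCaret (allRight i) i) 0 1 := by
  rw [addCaret_allRight_self]
  exact numLeaves_allRight (i + 1) ▸ mapsLeaves_one (allRight (i + 1))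

/-! ### Factorizations in terms of leaf maps -/

variable {D D' : MarkedDiagram} {p q : List ℕ} {i j k a : ℕ}

theorem MarkedDiagram.IsFactorization.mapsLeaves_p (h : D.IsFactorization p i j q) :
    MapsLeaves (i + 2) (allRight (i + 1)) D.target 0 (eval p) := by
  have h1 := D.positivePart.mapsLeaves_toT
  rw [← h.eval_p] at h1
  simpa only [MarkedDiagram.positivePart, BinaryTree.numLeaves_eq_numNodes_succ,
    h.numNodes_target] using h1

theorem MarkedDiagram.IsFactorization.mapsLeaves_q (h : D.IsFactorization p i j q) :
    MapsLeaves (i + 2) (allRight (i + 1)) D.source 0 (eval q) := by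
  have h1 := D.negativePart.mapsLeaves_toT
  rw [← h.eval_q] at h1
  simpa only [MarkedDiagram.negativePart, numLeaves_allRight, h.numNodes_target, inv_inv]
    using h1.inv

/-- The factorization fixes the mark only through the element `c i ^ j`; `mark_unique` recovers it.
-/
theorem MarkedDiagram.IsFactorization.mark_eq (h : D.IsFactorization p i j q) (hj : 1 ≤ j)
    (hji : j < i + 2) : D.mark = i + 2 - j := by
  have h1 := D.torsionPart.mapsLeaves_toT
  have h2 := D.mark_lt
  rw [← h.pow_c] at h1
  simp only [MarkedDiagram.torsionPart, numLeaves_allRight, h.numNodes_target] at h1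
  rw [BinaryTree.numLeaves_eq_numNodes_succ, h.numNodes_target] at h2
  exact h1.mark_unique h2 (by omega) (mapsLeaves_c_pow i hji.le)

theorem MarkedDiagram.isFactorization_of_mapsLeaves (hm : D.mark = i + 2 - j) (hj : j ≤ i + 2)
    (hp : p.Pairwise (· ≤ ·)) (hq : q.Pairwise (· ≤ ·))
    (h₁ : MapsLeaves (i + 2) (allRight (i + 1)) D.target 0 (eval p))
    (h₂ : MapsLeaves (i + 2) (allRight (i + 1)) D.source 0 (eval q)) :
    D.IsFactorization p i j q := by
  have hs := h₂.target
  have ht := h₁.target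
  have ht' := ht
  rw [BinaryTree.numLeaves_eq_numNodes_succ] at hs ht'
  have hn : D.target.numNodes = i + 1 := by omega
  refine ⟨by omega, hn, hp, ?_, ?_, hq, ?_⟩
  · have h3 := D.positivePart.mapsLeaves_toT
    have h4 : D.positivePart.target.numLeaves = i + 2 := ht
    have h5 : D.positivePart.source = allRight (i + 1) := congrArg allRight hn
    rw [h4, h5] at h3
    exact h₁.unique (by omega) h3
  · have h3 := D.torsionPart.mapsLeaves_toT
    have h5 : D.torsionPart.source = allRight (i + 1) := congrArg allRight hn
    have h6 : D.torsionPart.target = allRight (i + 1) := congrArg allRight hn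
    have h7 : D.torsionPart.mark = i + 2 - j := hm
    rw [h5, h6, h7, numLeaves_allRight] at h3
    exact (mapsLeaves_c_pow i hj).unique (by omega) h3
  · have h3 := D.negativePart.mapsLeaves_toT
    have h6 : D.negativePart.target = allRight (i + 1) := congrArg allRight hn
    rw [h6, numLeaves_allRight] at h3
    exact h₂.inv.unique (by omega) h3

/-- With the mark at `i + 2 - j`, leaf `a` has cyclic label `a + j` modulo `i + 2`, unreduced
exactly when `a` lies left of the mark. The new mark then belongs to the exponent `j` without a wrap
and to `j - 1` with one, for trees with `i + 1` leaves. -/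
theorem MarkedDiagram.ReducesTo.cases (h : D.ReducesTo k D') (hN : D.target.numLeaves = i + 2)
    (hm : D.mark = i + 2 - j) (hj : 1 ≤ j) (hji : j < i + 2) :
    ∃ a, a < D'.target.numLeaves ∧ k < D'.source.numLeaves ∧ D.source = addCaret D'.source k ∧
      D.target = addCaret D'.target a ∧
      (k = a + j ∧ D'.mark = i + 1 - j ∨ k + (i + 2) = a + j ∧ k + 2 ≤ j ∧ D'.mark = i + 2 - j) := by
  obtain ⟨hk, a, ha, h1, h2, h3⟩ := h
  obtain ⟨hk, hs⟩ := hk.lt_and_eq_addCaret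
  obtain ⟨ha, ht⟩ := ha.lt_and_eq_addCaret
  refine ⟨a, ha, hk, hs, ht, ?_⟩
  have h4 : D'.target.numLeaves + 1 = i + 2 := by rw [← numLeaves_addCaret _ a, ← ht, hN]
  simp only [MarkedDiagram.cyclicLabel, hN, hm] at h1 h2
  rw [hm] at h3
  rw [show a + (i + 2) - (i + 2 - j) = a + j by omega] at h1
  rw [show a + 1 + (i + 2) - (i + 2 - j) = a + 1 + j by omega] at h2
  split_ifs at h3 with h5
  · rw [Nat.mod_eq_of_lt (by omega)] at h1
    exact Or.inl ⟨h1.symm, by omega⟩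
  · rw [Nat.mod_eq_sub_mod (by omega), Nat.mod_eq_of_lt (by omega)] at h1 h2
    exact Or.inr ⟨by omega, by omega, h3⟩

end Thompson

/-! ### The four cases -/

theorem mainTheorem9 (D : Thompson.MarkedDiagram) (p : List ℕ) (i j : ℕ) (q : List ℕ)
    (hw : D.IsFactorization p i j q) (hj : 1 ≤ j) (hji : j < i + 2)
    (k : ℕ) (D' : Thompson.MarkedDiagram) (hD' : D.ReducesTo k D') :
    -- case (1)
    (j ≤ k ∧ k < i ∧ k - j ∈ p ∧ k ∈ q ∧ k - j + 1 ∉ p ∧ k + 1 ∉ q ∧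
      Thompson.x (k - j) * Thompson.c i ^ j * (Thompson.x k)⁻¹ = Thompson.c (i - 1) ^ j ∧
      ∃ p' q' : List ℕ, Thompson.FEquiv p (p' ++ [k - j]) ∧ Thompson.FEquiv q (q' ++ [k]) ∧
        D'.IsFactorization p' (i - 1) j q') ∨
    -- case (2)
    (k = i ∧ j ≤ i ∧ i - j ∈ p ∧ i - j + 1 ∉ p ∧
      Thompson.x (i - j) * Thompson.c i ^ j = Thompson.c (i - 1) ^ j ∧
      ∃ p' : List ℕ, Thompson.FEquiv p (p' ++ [i - j]) ∧
        D'.IsFactorization p' (i - 1) j q) ∨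
    -- case (3)
    (k + 2 < j ∧ k + i + 2 - j ∈ p ∧ k ∈ q ∧ k + i + 3 - j ∉ p ∧ k + 1 ∉ q ∧
      Thompson.x (k + i + 2 - j) * Thompson.c i ^ j * (Thompson.x k)⁻¹ =
        Thompson.c (i - 1) ^ (j - 1) ∧
      ∃ p' q' : List ℕ, Thompson.FEquiv p (p' ++ [k + i + 2 - j]) ∧
        Thompson.FEquiv q (q' ++ [k]) ∧ D'.IsFactorization p' (i - 1) (j - 1) q') ∨
    -- case (4)
    (2 ≤ j ∧ k = j - 2 ∧ j - 2 ∈ q ∧ j - 1 ∉ q ∧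
      Thompson.c i ^ j * (Thompson.x (j - 2))⁻¹ = Thompson.c (i - 1) ^ (j - 1) ∧
      ∃ q' : List ℕ, Thompson.FEquiv q (q' ++ [j - 2]) ∧
        D'.IsFactorization p (i - 1) (j - 1) q') := by
  -- For `i = 0` the only exponent is `j = 1`, which exchanges the two leaves and admits no
  -- reducible pair. So `i - 1` is never truncated.
  obtain ⟨n, rfl⟩ : ∃ n, i = n + 1 := by
    obtain ⟨a, ha, hk, hs, ht, h⟩ := hD'.cases hw.mapsLeaves_p.target (hw.mark_eq hj hji) hj hji
    have := hw.mapsLeaves_q.target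
    rw [hs, Thompson.numLeaves_addCaret] at this
    exact ⟨i - 1, by omega⟩
  have hP := hw.mapsLeaves_p
  have hQ := hw.mapsLeaves_q
  obtain ⟨a, ha, hk, hs, ht, h⟩ := hD'.cases hP.target (hw.mark_eq hj hji) hj hji
  rw [ht] at hP
  rw [hs] at hQ
  have hNt := hP.target
  have hNs := hQ.target
  rw [Thompson.numLeaves_addCaret] at hNt hNs
  replace hNt : D'.target.numLeaves = n + 1 + 1 := by omega
  replace hNs : D'.source.numLeaves = n + 1 + 1 := by omega
  rw [hNt] at ha
  rw [hNs] at hk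
  simp only [Nat.add_sub_cancel]
  have hx : ∀ {b : ℕ}, b < n + 1 → Thompson.MapsLeaves (n + 3) (Thompson.allRight (n + 2))
      (Thompson.addCaret (Thompson.allRight (n + 1)) b) 0 (Thompson.x b) :=
    fun hb => Thompson.mapsLeaves_x hb
  have h1 := Thompson.mapsLeaves_one_addCaret_last (n + 1)
  rcases h with ⟨rfl, hm⟩ | ⟨hka, hkj, hm⟩
  -- Without a wrap, `1 ≤ j` puts `a` strictly below `k = a + j`, so the target caret is off the
  -- last leaf; only the source caret may be on it, when `k = i`.
  · obtain ⟨hap, hap', p', hp, hp', hP'⟩ :=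
      Thompson.normalForm_addCaret hw.sorted_p hNt (show a < n + 1 by omega) hP
    rcases Nat.lt_or_ge (a + j) (n + 1) with hlt | hge
    · obtain ⟨hkq, hkq', q', hq, hq', hQ'⟩ :=
        Thompson.normalForm_addCaret hw.sorted_q hNs hlt hQ
      left
      rw [Nat.add_sub_cancel]
      exact ⟨by omega, hlt, hap, hkq, hap', hkq',
        Thompson.mul_c_pow_mul_inv (by omega) (by omega) hj hk ha (by omega) (hx (by omega)) (hx hlt),
        p', q', hp, hq,
        Thompson.MarkedDiagram.isFactorization_of_mapsLeaves hm (by omega) hp' hq' hP' hQ'⟩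
    · obtain hk' : a + j = n + 1 := by omega
      rw [hk'] at hQ
      have hrel := Thompson.mul_c_pow_mul_inv (j := j) (j' := j) (by omega) (by omega) hj
        (show n + 1 < n + 2 by omega) ha (by omega) (hx (show a < n + 1 by omega)) h1
      rw [inv_one, mul_one] at hrel
      right; left
      rw [← hk', Nat.add_sub_cancel, hk']
      exact ⟨rfl, by omega, hap, hap', hrel, p', hp,
        Thompson.MarkedDiagram.isFactorization_of_mapsLeaves hm (by omega) hp' hw.sorted_q hP'
          (Thompson.normalForm_addCaret_last hNs hQ)⟩
  -- With a wrap, `k < a`, so the roles are exchanged: only the target caret may be on the last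
  -- leaf, when `k + 2 = j`.
  · obtain ⟨hkq, hkq', q', hq, hq', hQ'⟩ :=
      Thompson.normalForm_addCaret hw.sorted_q hNs (show k < n + 1 by omega) hQ
    rcases hkj.lt_or_eq with hlt | heq
    · obtain ⟨hap, hap', p', hp, hp', hP'⟩ :=
        Thompson.normalForm_addCaret hw.sorted_p hNt (show a < n + 1 by omega) hP
      right; right; left
      rw [show k + (n + 1) + 2 - j = a by omega, show k + (n + 1) + 3 - j = a + 1 by omega]
      exact ⟨hlt, hap, hkq, hap', hkq',
        Thompson.mul_c_pow_mul_inv (by omega) (by omega) (by omega) hk ha (by omega)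
          (hx (by omega)) (hx (by omega)),
        p', q', hp, hq, Thompson.MarkedDiagram.isFactorization_of_mapsLeaves (by omega) (by omega)
          hp' hq' hP' hQ'⟩
    · subst heq
      obtain rfl : a = n + 1 := by omega
      have hrel := Thompson.mul_c_pow_mul_inv (j := k + 2) (j' := k + 1) (by omega) (by omega)
        (by omega) hk ha (by omega) h1 (hx (by omega))
      rw [one_mul] at hrel
      right; right; right
      exact ⟨by omega, rfl, hkq, hkq', hrel, q', hq,
        Thompson.MarkedDiagram.isFactorization_of_mapsLeaves (by omega) (by omega) hw.sorted_p hq'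
          (Thompson.normalForm_addCaret_last hNt hP) hQ'⟩
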